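/- Let $q\in\mathbb{C}$ with $0<|q|<1$, let $\alpha,h_1,h_2,h_3,l_1,l_2,l_3\in\mathbb{C}$, let $t_1,t_2,t_3\in\mathbb{C}\setminus\{0\}$, and set $\lambda=(h_1+h_2+h_3-l_1-l_2-l_3+1)/2$. Fix a logarithm $\tau$ of $q$ and put $q^a=e^{a\tau}$. Functions of $x\neq0$ are considered on the universal cover of $\mathbb{C}\setminus\{0\}$, that is, $x=e^u$, $x^a=e^{au}$, and $x/q$, $qx$ correspond to $u-\tau$, $u+\tau$. Write $(a;q)_n=\prod_{k=0}^{n-1}(1-aq^k)$, $(a;q)_\infty=\prod_{k=0}^\infty(1-aq^k)$, $(a_1,\dots,a_N;q)_\infty=\prod_j (a_j;q)_\infty$, and $${}_4\phi_3\left({a_1,a_2,a_3,a_4\atop b_1,b_2,b_3};q,z\right)=\sum_{n=0}^\infty\frac{(a_1;q)_n(a_2;q)_n(a_3;q)_n(a_4;q)_n}{(q;q)_n(b_1;q)_n(b_2;q)_n(b_3;q)_n}z^n .$$ Consider the non-homogeneous equation $$\begin{aligned} &(x-q^{h_1+1/2}t_1)(x-q^{h_2+1/2}t_2)(x-q^{h_3+1/2}t_3)\,g(x/q)\\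 &+q^{2\alpha+1}(x-q^{l_1-1/2}t_1)(x-q^{l_2-1/2}t_2)(x-q^{l_3-1/2}t_3)\,g(qx)\\ &+q^{\alpha}\bigl[-(q+1)x^3+q^{1/2}\{(q^{h_1}+q^{l_1})t_1+(q^{h_2}+q^{l_2})t_2+(q^{h_3}+q^{l_3})t_3\}x^2\\ &\quad-q^{(h_1+h_2+h_3+l_1+l_2+l_3+1)/2}\{(q^{-h_1}+q^{-l_1})t_2t_3+(q^{-h_2}+q^{-l_2})t_1t_3+(q^{-h_3}+q^{-l_3})t_1t_2\}x\\ &\quad+q^{(h_1+h_2+h_3+l_1+l_2+l_3)/2}(q+1)t_1t_2t_3\bigr]g(x)\\ &-q^{\alpha+l_1+l_2+l_3-1/2}t_1t_2t_3(1-q^\lambda)x^{1-\alpha}=0.\qquad(*) \end{aligned}$$ (i) For every permutation $(i,i',i'')$ of $(1,2,3)$, the function $$\begin{aligned} g_i^{\langle1\rangle}(x)={}&x^{-\alpha}q^{l_i-1/2}t_i\frac{(q^{\lambda+l_i+1/2}t_i/x,\;q^{l_i-l_{i'}+1}t_i/t_{i'},\;q^{l_i-l_{i''}+1}t_i/t_{i''},\;q;q)_\infty}{(q^{l_i+1/2}t_i/x,\;q^{\lambda+l_i-h_i},\;q^{\lambda+l_i-h_{i'}}t_i/t_{i'},\;q^{\lambda+l_i-h_{i''}}t_i/t_{i''};q)_\infty}\\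 &\times{}_4\phi_3\left({q^{l_i+1/2}t_i/x,\;q^{\lambda+l_i-h_i},\;q^{\lambda+l_i-h_{i'}}t_i/t_{i'},\;q^{\lambda+l_i-h_{i''}}t_i/t_{i''}\atop q^{\lambda+l_i+1/2}t_i/x,\;q^{l_i-l_{i'}+1}t_i/t_{i'},\;q^{l_i-l_{i''}+1}t_i/t_{i''}};q,q\right) \end{aligned}$$ satisfies $(*)$. (ii) The function $$\begin{aligned} g_0^{\langle1\rangle}(x)={}&x^{1-\alpha}q^{-\lambda}\frac{(xq^{-\lambda-l_1+3/2}/t_1,\;xq^{-\lambda-l_2+3/2}/t_2,\;xq^{-\lambda-l_3+3/2}/t_3,\;q;q)_\infty}{(xq^{-h_1+1/2}/t_1,\;xq^{-h_2+1/2}/t_2,\;xq^{-h_3+1/2}/t_3,\;q^{-\lambda+1};q)_\infty}\\ &\times{}_4\phi_3\left({xq^{-h_1+1/2}/t_1,\;xq^{-h_2+1/2}/t_2,\;xq^{-h_3+1/2}/t_3,\;q^{-\lambda+1}\atop xq^{-\lambda-l_1+3/2}/t_1,\;xq^{-\lambda-l_2+3/2}/t_2,\;xq^{-\lambda-l_3+3/2}/t_3};q,q\right)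 \end{aligned}$$ also satisfies $(*)$. In both cases the function is regarded as defined at $x$ when no denominator in its formula vanishes, i.e. when no upper or lower parameter of its ${}_4\phi_3$ equals $q^{-n}$ with $n\in\{0,1,2,\dots\}$; at such $x$ the ${}_4\phi_3$ series converges absolutely, and $(*)$ holds at every $x$ such that the function is defined at $x/q$, $x$ and $qx$. -/

import Mathlib

/-- The power `w ^ a = exp (a * L)` of a nonzero complex number `w`, formed with a chosen
logarithm `L` of `w` (so `exp L = w`). -/
noncomputable def powLog (L a : ℂ) : ℂ := Complex.exp (a * L)

/-- The finite `q`-Pochhammer symbol `(a; q)_n`. -/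
noncomputable def qPoch (a q : ℂ) (n : ℕ) : ℂ := ∏ k ∈ Finset.range n, (1 - a * q ^ k)

/-- The infinite `q`-Pochhammer symbol `(a; q)_∞`. -/
noncomputable def qPochInf (a q : ℂ) : ℂ := ∏' k : ℕ, (1 - a * q ^ k)

/-- The infinite product defining `(a; q)_∞` converges for `|q| < 1`. -/
theorem multipliable_qPochInf (a q : ℂ) (hq : ‖q‖ < 1) :
    Multipliable fun k : ℕ => 1 - a * q ^ k := by
  have h : Summable fun k : ℕ => ‖-(a * q ^ k)‖ := by
    simpa [norm_mul, norm_pow] using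
      (summable_geometric_of_lt_one (norm_nonneg q) hq).mul_left ‖a‖
  simpa [sub_eq_add_neg] using multipliable_one_add_of_summable h

/-- The `n`-th term of the basic hypergeometric series `_{r+1}φ_r(a; b; q, z)`. -/
noncomputable def qHypTerm {r : ℕ} (a : Fin (r + 1) → ℂ) (b : Fin r → ℂ) (q z : ℂ) (n : ℕ) : ℂ :=
  (∏ j, qPoch (a j) q n) / (qPoch q q n * ∏ j, qPoch (b j) q n) * z ^ n

/-- The basic hypergeometric series `_{r+1}φ_r(a; b; q, z)`. -/
noncomputable def qHyp {r : ℕ} (a : Fin (r + 1) → ℂ) (b : Fin r → ℂ) (q z : ℂ) : ℂ :=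
  ∑' n : ℕ, qHypTerm a b q z n

/-- No factor `1 - c q^n` of `(c; q)_∞` vanishes, for `c` any of the parameters `a`, `b`. -/
def QRegular {r s : ℕ} (a : Fin r → ℂ) (b : Fin s → ℂ) (q : ℂ) : Prop :=
  (∀ j, ∀ n : ℕ, a j * q ^ n ≠ 1) ∧ (∀ j, ∀ n : ℕ, b j * q ^ n ≠ 1)

namespace QDegThree

/-! Conventions: `τ` is a chosen logarithm of `q`. Functions of `x` that contain complex powers
of `x` live on the universal cover of `ℂ \ {0}`: they are functions of a logarithm `u` of `x`, so
`x = exp u`, `x ^ a = exp (a * u)`, and `x / q`, `q * x` correspond to `u - τ`, `u + τ`.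
The indices `1, 2, 3` are `0, 1, 2 : Fin 3`. -/

/-- `λ = (h₁ + h₂ + h₃ - l₁ - l₂ - l₃ + 1) / 2`. -/
noncomputable def lam (h l : Fin 3 → ℂ) : ℂ :=
  (h 0 + h 1 + h 2 - l 0 - l 1 - l 2 + 1) / 2

/-- The left-hand side of the homogeneous variant of the `q`-hypergeometric equation of degree
three, applied to `g` at the point `x = exp u`. -/
noncomputable def variantLHS (τ α : ℂ) (h l t : Fin 3 → ℂ) (g : ℂ → ℂ) (u : ℂ) : ℂ :=
  let q : ℂ := Complex.exp τ
  let x : ℂ := Complex.exp u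
  (x - powLog τ (h 0 + 1 / 2) * t 0) * (x - powLog τ (h 1 + 1 / 2) * t 1)
      * (x - powLog τ (h 2 + 1 / 2) * t 2) * g (u - τ)
    + powLog τ (2 * α + 1) * (x - powLog τ (l 0 - 1 / 2) * t 0)
      * (x - powLog τ (l 1 - 1 / 2) * t 1) * (x - powLog τ (l 2 - 1 / 2) * t 2) * g (u + τ)
    + powLog τ α *
      (-(q + 1) * x ^ 3
        + powLog τ (1 / 2) *
          ((powLog τ (h 0) + powLog τ (l 0)) * t 0 + (powLog τ (h 1) + powLog τ (l 1)) * t 1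
            + (powLog τ (h 2) + powLog τ (l 2)) * t 2) * x ^ 2
        - powLog τ ((h 0 + h 1 + h 2 + l 0 + l 1 + l 2 + 1) / 2) *
          ((powLog τ (-h 0) + powLog τ (-l 0)) * t 1 * t 2
            + (powLog τ (-h 1) + powLog τ (-l 1)) * t 0 * t 2
            + (powLog τ (-h 2) + powLog τ (-l 2)) * t 0 * t 1) * x
        + powLog τ ((h 0 + h 1 + h 2 + l 0 + l 1 + l 2) / 2) * (q + 1) * t 0 * t 1 * t 2) * g u

/-- The non-homogeneous equation for `g` at the point `x = exp u`. -/
def SatisfiesNonhom (τ α : ℂ) (h l t : Fin 3 → ℂ) (g : ℂ → ℂ) (u : ℂ) : Prop :=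
  variantLHS τ α h l t g u
    - powLog τ (α + l 0 + l 1 + l 2 - 1 / 2) * t 0 * t 1 * t 2 * (1 - powLog τ (lam h l))
      * powLog u (1 - α) = 0

/-- Upper parameters of the `₄φ₃` in `g_i`, where `(i, i', i'') = (σ 0, σ 1, σ 2)`. -/
noncomputable def upperI (τ : ℂ) (h l t : Fin 3 → ℂ) (σ : Equiv.Perm (Fin 3)) (u : ℂ) :
    Fin 4 → ℂ :=
  ![powLog τ (l (σ 0) + 1 / 2) * t (σ 0) / Complex.exp u,
    powLog τ (lam h l + l (σ 0) - h (σ 0)),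
    powLog τ (lam h l + l (σ 0) - h (σ 1)) * t (σ 0) / t (σ 1),
    powLog τ (lam h l + l (σ 0) - h (σ 2)) * t (σ 0) / t (σ 2)]

/-- Lower parameters of the `₄φ₃` in `g_i`. -/
noncomputable def lowerI (τ : ℂ) (h l t : Fin 3 → ℂ) (σ : Equiv.Perm (Fin 3)) (u : ℂ) :
    Fin 3 → ℂ :=
  ![powLog τ (lam h l + l (σ 0) + 1 / 2) * t (σ 0) / Complex.exp u,
    powLog τ (l (σ 0) - l (σ 1) + 1) * t (σ 0) / t (σ 1),
    powLog τ (l (σ 0) - l (σ 2) + 1) * t (σ 0) / t (σ 2)]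

/-- The function `g_i`, `i = σ 0`. -/
noncomputable def gI (τ α : ℂ) (h l t : Fin 3 → ℂ) (σ : Equiv.Perm (Fin 3)) (u : ℂ) : ℂ :=
  let q : ℂ := Complex.exp τ
  let a := upperI τ h l t σ u
  let b := lowerI τ h l t σ u
  powLog u (-α) * powLog τ (l (σ 0) - 1 / 2) * t (σ 0)
    * ((qPochInf (b 0) q * qPochInf (b 1) q * qPochInf (b 2) q * qPochInf q q)
      / (qPochInf (a 0) q * qPochInf (a 1) q * qPochInf (a 2) q * qPochInf (a 3) q))
    * qHyp a b q q

/-- Upper parameters of the `₄φ₃` in `g_0`. -/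
noncomputable def upperZero (τ : ℂ) (h l t : Fin 3 → ℂ) (u : ℂ) : Fin 4 → ℂ :=
  ![Complex.exp u * powLog τ (-h 0 + 1 / 2) / t 0,
    Complex.exp u * powLog τ (-h 1 + 1 / 2) / t 1,
    Complex.exp u * powLog τ (-h 2 + 1 / 2) / t 2,
    powLog τ (-lam h l + 1)]

/-- Lower parameters of the `₄φ₃` in `g_0`. -/
noncomputable def lowerZero (τ : ℂ) (h l t : Fin 3 → ℂ) (u : ℂ) : Fin 3 → ℂ :=
  ![Complex.exp u * powLog τ (-lam h l - l 0 + 3 / 2) / t 0,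
    Complex.exp u * powLog τ (-lam h l - l 1 + 3 / 2) / t 1,
    Complex.exp u * powLog τ (-lam h l - l 2 + 3 / 2) / t 2]

/-- The function `g_0`. -/
noncomputable def gZero (τ α : ℂ) (h l t : Fin 3 → ℂ) (u : ℂ) : ℂ :=
  let q : ℂ := Complex.exp τ
  let a := upperZero τ h l t u
  let b := lowerZero τ h l t u
  powLog u (1 - α) * powLog τ (-lam h l)
    * ((qPochInf (b 0) q * qPochInf (b 1) q * qPochInf (b 2) q * qPochInf q q)
      / (qPochInf (a 0) q * qPochInf (a 1) q * qPochInf (a 2) q * qPochInf (a 3) q))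
    * qHyp a b q q

/-- All denominators in the formula for `g_i` at `x = exp u` are nonzero. -/
def DefinedI (τ : ℂ) (h l t : Fin 3 → ℂ) (σ : Equiv.Perm (Fin 3)) (u : ℂ) : Prop :=
  QRegular (upperI τ h l t σ u) (lowerI τ h l t σ u) (Complex.exp τ)

/-- All denominators in the formula for `g_0` at `x = exp u` are nonzero. -/
def DefinedZero (τ : ℂ) (h l t : Fin 3 → ℂ) (u : ℂ) : Prop :=
  QRegular (upperZero τ h l t u) (lowerZero τ h l t u) (Complex.exp τ)

end QDegThree

/-! Writing `g = x^(-α) k` removes `α`. With `a j`, `b j` the zeros of the coefficients of `g (x/q)`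
and `g (qx)`, and `L = q^λ`, the equation becomes `∏ (x - a j) · k (x/q) + q ∏ (x - b j) · k (qx) +
midCoeff · k x = q b₀b₁b₂ (1 - L) x`, and the definition of `λ` becomes `a₀a₁a₂ = q² L² b₀b₁b₂`.

Both solutions are Jackson sums `k y = ∑ jackTerm y s` over a geometric lattice of `s` with ratio
`q`: from `s = b i` for `g_i`, and from `s = y / L` for `g_0`. Absorbing the normalizing infinite
products into the `₄φ₃` gives exactly these sums.

For fixed `s`, the left side applied to `jackTerm` is the `q`-difference `jackPrim (q s) - jackPrim
s` (`jackPrim_step`), so the sums telescope. As `s → 0`, `jackPrim` tends to the right side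
(`tendsto_jackPrim`), which is where the inhomogeneous term comes from. The lower end contributes
nothing: at `s = b i` a factor `(1; q)_∞` vanishes. For `s = y / L` the lattice moves with `y`, and
the unmatched first terms cancel the boundary value (`jackPrim_initial`). -/

open Filter Topology

/-! ### Infinite `q`-Pochhammer symbols and their tails. -/

theorem qPochInf_eq_mul (z q : ℂ) (hq : ‖q‖ < 1) :
    qPochInf z q = (1 - z) * qPochInf (q * z) q := by
  have e : (fun k : ℕ => 1 - z * q ^ (k + 1)) = fun k : ℕ => 1 - q * z * q ^ k := by
    funext k
    ring
  have h : Multipliable fun k : ℕ => 1 - z * q ^ (k + 1) := by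
    rw [e]
    exact multipliable_qPochInf (q * z) q hq
  have h1 := tprod_eq_zero_mul' (f := fun k : ℕ => 1 - z * q ^ k) h
  rw [e, pow_zero, mul_one] at h1
  exact h1

theorem qPochInf_eq_qPoch_mul (z q : ℂ) (hq : ‖q‖ < 1) (n : ℕ) :
    qPochInf z q = qPoch z q n * qPochInf (z * q ^ n) q := by
  induction n with
  | zero => simp [qPoch]
  | succ n ih =>
    rw [ih, qPochInf_eq_mul (z * q ^ n) q hq]
    simp only [qPoch, Finset.prod_range_succ]
    rw [show q * (z * q ^ n) = z * q ^ (n + 1) by ring]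
    ring

theorem qPochInf_one (q : ℂ) (hq : ‖q‖ < 1) : qPochInf 1 q = 0 := by
  simp [qPochInf_eq_mul 1 q hq]

theorem qPochInf_ne_zero {z q : ℂ} (hq : ‖q‖ < 1) (h : ∀ n : ℕ, z * q ^ n ≠ 1) :
    qPochInf z q ≠ 0 := by
  have hs : Summable fun k : ℕ => ‖-(z * q ^ k)‖ := by
    simpa [norm_mul, norm_pow] using
      (summable_geometric_of_lt_one (norm_nonneg q) hq).mul_left ‖z‖
  have := tprod_one_add_ne_zero_of_summable (f := fun k : ℕ => -(z * q ^ k))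
    (fun k => by
      rw [← sub_eq_add_neg, sub_ne_zero]
      exact (h k).symm) hs
  simpa [qPochInf, sub_eq_add_neg] using this

theorem norm_qPochInf_sub_one_le (z q : ℂ) (hq : ‖q‖ < 1) :
    ‖qPochInf z q - 1‖ ≤ Real.exp (‖z‖ * (1 - ‖q‖)⁻¹) - 1 := by
  have hp := (multipliable_qPochInf z q hq).hasProd.tendsto_prod_nat
  refine le_of_tendsto ((hp.sub_const 1).norm) (Eventually.of_forall fun n => ?_)
  have := (Finset.range n).norm_prod_one_add_sub_one_le (fun k : ℕ => -(z * q ^ k))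
  simp only [← sub_eq_add_neg] at this
  refine this.trans (sub_le_sub_right (Real.exp_le_exp.2 ?_) _)
  have hg := summable_geometric_of_lt_one (norm_nonneg q) hq
  simp only [norm_neg, norm_mul, norm_pow, ← Finset.mul_sum]
  rw [← tsum_geometric_of_lt_one (norm_nonneg q) hq]
  exact mul_le_mul_of_nonneg_left
    (hg.sum_le_tsum _ fun i _ => by positivity) (norm_nonneg z)

theorem tendsto_qPochInf_mul_pow (z q : ℂ) (hq : ‖q‖ < 1) :
    Tendsto (fun n : ℕ => qPochInf (z * q ^ n) q) atTop (𝓝 1) := by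
  rw [tendsto_iff_norm_sub_tendsto_zero]
  refine squeeze_zero (fun _ => norm_nonneg _)
    (fun n => norm_qPochInf_sub_one_le (z * q ^ n) q hq) ?_
  have h0 : Tendsto (fun n : ℕ => ‖z * q ^ n‖ * (1 - ‖q‖)⁻¹) atTop (𝓝 0) := by
    have := (((tendsto_pow_atTop_nhds_zero_of_norm_lt_one hq).const_mul z).norm).mul_const
      (1 - ‖q‖)⁻¹
    simpa using this
  simpa using ((Real.continuous_exp.tendsto 0).comp h0).sub_const 1

/-! ### The normalized `₄φ₃` and its convergence. -/

/-- The summand of a normalized balanced `₄φ₃` at `z = q`, with the `q`-Pochhammer symbols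
collected into infinite products. -/
noncomputable def normTerm (a : Fin 4 → ℂ) (b : Fin 3 → ℂ) (q : ℂ) (n : ℕ) : ℂ :=
  q ^ n * ((qPochInf (b 0 * q ^ n) q * qPochInf (b 1 * q ^ n) q * qPochInf (b 2 * q ^ n) q
      * qPochInf (q * q ^ n) q)
    / (qPochInf (a 0 * q ^ n) q * qPochInf (a 1 * q ^ n) q * qPochInf (a 2 * q ^ n) q
      * qPochInf (a 3 * q ^ n) q))

/-- The ratio of infinite products normalizing a `₄φ₃`. -/
noncomputable def normFactor (a : Fin 4 → ℂ) (b : Fin 3 → ℂ) (q : ℂ) : ℂ :=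
  (qPochInf (b 0) q * qPochInf (b 1) q * qPochInf (b 2) q * qPochInf q q)
      / (qPochInf (a 0) q * qPochInf (a 1) q * qPochInf (a 2) q * qPochInf (a 3) q)

theorem mul_pow_ne_one_self {q : ℂ} (hq : ‖q‖ < 1) (n : ℕ) : q * q ^ n ≠ 1 := by
  intro h
  have h1 : ‖q‖ ^ (n + 1) = 1 := by
    rw [← norm_pow, pow_succ', h, norm_one]
  exact (pow_lt_one₀ (norm_nonneg q) hq (Nat.succ_ne_zero n)).ne h1

theorem normFactor_ne_zero {a : Fin 4 → ℂ} {b : Fin 3 → ℂ} {q : ℂ} (hq : ‖q‖ < 1)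
    (hab : QRegular a b q) : normFactor a b q ≠ 0 := by
  have hA := fun j => qPochInf_ne_zero hq (hab.1 j)
  have hB := fun j => qPochInf_ne_zero hq (hab.2 j)
  have hQ := qPochInf_ne_zero hq (mul_pow_ne_one_self hq)
  exact div_ne_zero (mul_ne_zero (mul_ne_zero (mul_ne_zero (hB 0) (hB 1)) (hB 2)) hQ)
    (mul_ne_zero (mul_ne_zero (mul_ne_zero (hA 0) (hA 1)) (hA 2)) (hA 3))

/-- Each finite symbol is `(z; q)_∞ / (z q^n; q)_∞`, so the normalizing factor cancels and the
summand depends on `n` only through the lattice point. -/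
theorem normFactor_mul_qHypTerm {a : Fin 4 → ℂ} {b : Fin 3 → ℂ} {q : ℂ} (hq : ‖q‖ < 1)
    (hab : QRegular a b q) (n : ℕ) :
    normFactor a b q * qHypTerm a b q q n = normTerm a b q n := by
  have key : ∀ z : ℂ, (∀ n : ℕ, z * q ^ n ≠ 1) →
      qPochInf z q ≠ 0 ∧ qPoch z q n ≠ 0 ∧
        qPochInf (z * q ^ n) q = qPochInf z q / qPoch z q n := by
    intro z hz
    have h0 := qPochInf_ne_zero hq hz
    have h1 := qPochInf_eq_qPoch_mul z q hq n
    have h2 : qPoch z q n ≠ 0 := by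
      intro h
      rw [h, zero_mul] at h1
      exact h0 h1
    exact ⟨h0, h2, by rw [h1]; field_simp⟩
  obtain ⟨p0, p1, p2⟩ := key _ (hab.1 0)
  obtain ⟨q0, q1, q2⟩ := key _ (hab.1 1)
  obtain ⟨r0, r1, r2⟩ := key _ (hab.1 2)
  obtain ⟨s0, s1, s2⟩ := key _ (hab.1 3)
  obtain ⟨u0, u1, u2⟩ := key _ (hab.2 0)
  obtain ⟨v0, v1, v2⟩ := key _ (hab.2 1)
  obtain ⟨w0, w1, w2⟩ := key _ (hab.2 2)
  obtain ⟨x0, x1, x2⟩ := key _ (mul_pow_ne_one_self hq)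
  rw [normTerm, normFactor, qHypTerm, p2, q2, r2, s2, u2, v2, w2, x2,
    Fin.prod_univ_four, Fin.prod_univ_three]
  field_simp

/-- All tail products tend to `1`, so the terms are `O(q^n)`. No regularity is needed: vanishing
denominators can occur only at finitely many `n`. -/
theorem summable_norm_normTerm (a : Fin 4 → ℂ) (b : Fin 3 → ℂ) {q : ℂ} (hq : ‖q‖ < 1) :
    Summable fun n : ℕ => ‖normTerm a b q n‖ := by
  have T := fun z => tendsto_qPochInf_mul_pow z q hq
  have h := ((((T (b 0)).mul (T (b 1))).mul (T (b 2))).mul (T q)).div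
    ((((T (a 0)).mul (T (a 1))).mul (T (a 2))).mul (T (a 3))) (by norm_num)
  have hO' := (Asymptotics.isBigO_refl (fun n : ℕ => q ^ n) atTop).mul (h.isBigO_one ℂ)
  have hg : Summable fun n : ℕ => ‖q ^ n * (1 : ℂ)‖ := by
    simpa [norm_pow] using summable_geometric_of_lt_one (norm_nonneg q) hq
  refine summable_of_isBigO_nat hg ?_
  exact hO'.norm_norm

theorem summable_norm_qHypTerm {a : Fin 4 → ℂ} {b : Fin 3 → ℂ} {q : ℂ} (hq : ‖q‖ < 1)
    (hab : QRegular a b q) : Summable fun n : ℕ => ‖qHypTerm a b q q n‖ := by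
  have h0 := normFactor_ne_zero hq hab
  have h := (summable_norm_normTerm a b hq).mul_left ‖(normFactor a b q)⁻¹‖
  refine h.congr fun n => ?_
  rw [← norm_mul, ← normFactor_mul_qHypTerm hq hab, inv_mul_cancel_left₀ h0]

theorem hasSum_normTerm {a : Fin 4 → ℂ} {b : Fin 3 → ℂ} {q : ℂ} (hq : ‖q‖ < 1)
    (hab : QRegular a b q) :
    HasSum (normTerm a b q) (normFactor a b q * qHyp a b q q) := by
  have h := ((summable_norm_qHypTerm hq hab).of_norm.hasSum).mul_left (normFactor a b q)
  have e : (fun n => normFactor a b q * qHypTerm a b q q n) = normTerm a b q :=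
    funext fun n => normFactor_mul_qHypTerm hq hab n
  rw [e] at h
  exact h

/-! ### The Jackson summand and its telescoping certificate. -/

/-- The coefficient of `g x` in the degree three equation, in terms of the zeros `a j`, `b j` of
the other two coefficients and of `L = q ^ λ`. -/
noncomputable def midCoeff (q L : ℂ) (a b : Fin 3 → ℂ) (x : ℂ) : ℂ :=
  -(q + 1) * x ^ 3 + ((a 0 + q * b 0) + (a 1 + q * b 1) + (a 2 + q * b 2)) * x ^ 2
    - ((a 1 * a 2 + a 0 * a 2 + a 0 * a 1) / L
        + q * L * (b 1 * b 2 + b 0 * b 2 + b 0 * b 1)) * x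
    + q * L * (q + 1) * (b 0 * b 1 * b 2)

/-- The summand of the Jackson integral representing a solution at `y`. -/
noncomputable def jackTerm (q L : ℂ) (a b : Fin 3 → ℂ) (y s : ℂ) : ℂ :=
  s * ((qPochInf (q * s / b 0) q * qPochInf (q * s / b 1) q * qPochInf (q * s / b 2) q)
    / (qPochInf (q * L * s / a 0) q * qPochInf (q * L * s / a 1) q
      * qPochInf (q * L * s / a 2) q))
    * (qPochInf (q * L * s / y) q / qPochInf (q * s / y) q)

/-- The primitive of the combination of the `jackTerm`s entering the equation at `x`. -/
noncomputable def jackPrim (q L : ℂ) (a b : Fin 3 → ℂ) (x s : ℂ) : ℂ :=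
  q * (b 0 * b 1 * b 2) * (1 - L) * x
    * ((qPochInf (s / b 0) q * qPochInf (s / b 1) q * qPochInf (s / b 2) q)
    / (qPochInf (q * L * s / a 0) q * qPochInf (q * L * s / a 1) q
      * qPochInf (q * L * s / a 2) q))
    * (qPochInf (q * L * s / x) q / qPochInf (s / x) q)

/-- This is `jackPrim_step` with the common infinite products divided out and the denominators in
`x` and `a j` cleared. Eliminating `b 0` through `hab` leaves a rational identity in free variables.
-/
theorem certificate_identity {q L x : ℂ} {a b : Fin 3 → ℂ} (s : ℂ) (hq : q ≠ 0) (hL : L ≠ 0)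
    (hx : x ≠ 0) (ha : ∀ j, a j ≠ 0) (hb : ∀ j, b j ≠ 0)
    (hab : a 0 * a 1 * a 2 = q ^ 2 * L ^ 2 * (b 0 * b 1 * b 2)) :
    s * ((x - a 0) * (x - a 1) * (x - a 2) * ((1 - s / x) * (1 - q * s / x))
      + q * ((x - b 0) * (x - b 1) * (x - b 2)) * ((1 - L * s / x) * (1 - q * L * s / x))
      + midCoeff q L a b x * ((1 - q * L * s / x) * (1 - s / x)))
    = q * (b 0 * b 1 * b 2) * (1 - L) * x *
      ((1 - q * L * s / a 0) * (1 - q * L * s / a 1) * (1 - q * L * s / a 2) * (1 - s / x)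
        - (1 - s / b 0) * (1 - s / b 1) * (1 - s / b 2) * (1 - q * L * s / x)) := by
  have a0 := ha 0
  have a1 := ha 1
  have a2 := ha 2
  have b0 := hb 0
  have b1 := hb 1
  have b2 := hb 2
  have h0 : b 0 = a 0 * a 1 * a 2 / (q ^ 2 * L ^ 2 * b 1 * b 2) := by
    rw [hab]
    field_simp
  rw [midCoeff, h0]
  field_simp
  ring

/-- This is `jackPrim_initial` with the common products divided out. The factor `-(a 0 * a 1 * a 2)`
is `∏ (x - a j) / ∏ (1 - x / a j)`, left over from the point `s = x / (q L)`. -/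
theorem initial_identity {q L x : ℂ} {a b : Fin 3 → ℂ} (hq : q ≠ 0) (hL : L ≠ 0)
    (ha : ∀ j, a j ≠ 0) (hb : ∀ j, b j ≠ 0)
    (hab : a 0 * a 1 * a 2 = q ^ 2 * L ^ 2 * (b 0 * b 1 * b 2)) :
    -(a 0 * a 1 * a 2) * (x / (q * L))
        * ((1 - x / (L * b 0)) * (1 - x / (L * b 1)) * (1 - x / (L * b 2))) * (1 - q)
      + (x - a 0) * (x - a 1) * (x - a 2) * (x / L) * (1 - q / L)
      + midCoeff q L a b x * (x / L) * (1 - q)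
    = q * (b 0 * b 1 * b 2) * (1 - L) * x
      * ((1 - q * x / a 0) * (1 - q * x / a 1) * (1 - q * x / a 2)) := by
  have a0 := ha 0
  have a1 := ha 1
  have a2 := ha 2
  have b0 := hb 0
  have b1 := hb 1
  have b2 := hb 2
  have h0 : b 0 = a 0 * a 1 * a 2 / (q ^ 2 * L ^ 2 * b 1 * b 2) := by
    rw [hab]
    field_simp
  rw [midCoeff, h0]
  field_simp
  ring

theorem jackPrim_step {q L x s : ℂ} {a b : Fin 3 → ℂ} (hq : ‖q‖ < 1) (hq0 : q ≠ 0) (hL : L ≠ 0)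
    (hx : x ≠ 0) (ha : ∀ j, a j ≠ 0) (hb : ∀ j, b j ≠ 0)
    (hab : a 0 * a 1 * a 2 = q ^ 2 * L ^ 2 * (b 0 * b 1 * b 2))
    (hw : ∀ j, q * L * s / a j ≠ 1) (h1 : s / x ≠ 1) (h2 : q * s / x ≠ 1) :
    (x - a 0) * (x - a 1) * (x - a 2) * jackTerm q L a b (x / q) s
      + q * ((x - b 0) * (x - b 1) * (x - b 2)) * jackTerm q L a b (q * x) s
      + midCoeff q L a b x * jackTerm q L a b x s
    = jackPrim q L a b x (q * s) - jackPrim q L a b x s := by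
  have E := fun z => qPochInf_eq_mul z q hq
  have key := certificate_identity s hq0 hL hx ha hb hab
  have hw' : ∀ j, 1 - q * L * s / a j ≠ 0 := fun j => sub_ne_zero.2 (hw j).symm
  have h1' : 1 - s / x ≠ 0 := sub_ne_zero.2 h1.symm
  have h2' : 1 - q * s / x ≠ 0 := sub_ne_zero.2 h2.symm
  have w0 := hw' 0
  have w1 := hw' 1
  have w2 := hw' 2
  simp only [jackTerm, jackPrim]
  rw [show q * L * s / (q * x) = L * s / x by field_simp,
    show q * s / (q * x) = s / x by field_simp,
    show q * L * s / (x / q) = q * (q * L * s / x) by field_simp,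
    show q * s / (x / q) = q * (q * s / x) by field_simp,
    E (s / x), E (L * s / x), show q * (s / x) = q * s / x by ring,
    show q * (L * s / x) = q * L * s / x by ring, E (q * s / x), E (q * L * s / x),
    E (q * L * s / a 0), E (q * L * s / a 1), E (q * L * s / a 2),
    E (s / b 0), E (s / b 1), E (s / b 2)]
  rw [show q * L * (q * s) / a 0 = q * (q * L * s / a 0) by ring,
    show q * L * (q * s) / a 1 = q * (q * L * s / a 1) by ring,
    show q * L * (q * s) / a 2 = q * (q * L * s / a 2) by ring,
    show q * L * (q * s) / x = q * (q * L * s / x) by ring,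
    show q * (s / b 0) = q * s / b 0 by ring,
    show q * (s / b 1) = q * s / b 1 by ring,
    show q * (s / b 2) = q * s / b 2 by ring]
  generalize qPochInf (q * (q * L * s / a 0)) q = v0
  generalize qPochInf (q * (q * L * s / a 1)) q = v1
  generalize qPochInf (q * (q * L * s / a 2)) q = v2
  generalize qPochInf (q * (q * L * s / x)) q = m
  generalize qPochInf (q * (q * s / x)) q = d
  generalize qPochInf (q * s / b 0) q = u0
  generalize qPochInf (q * s / b 1) q = u1
  generalize qPochInf (q * s / b 2) q = u2
  generalize midCoeff q L a b x = C at *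
  generalize q * L * s / a 0 = α0 at *
  generalize q * L * s / a 1 = α1 at *
  generalize q * L * s / a 2 = α2 at *
  generalize s / b 0 = β0 at *
  generalize s / b 1 = β1 at *
  generalize s / b 2 = β2 at *
  generalize s / x = X at *
  generalize q * s / x = Y at *
  generalize L * s / x = Z at *
  generalize q * L * s / x = W at *
  clear hw hw' h1 h2 hab ha hb hq hq0 hL hx E
  simp only [div_eq_mul_inv, mul_inv]
  -- The tail products are not known to be nonzero here, so their inverses are kept as free
  -- variables that `field_simp` need not cancel.
  generalize v0⁻¹ = V0
  generalize v1⁻¹ = V1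
  generalize v2⁻¹ = V2
  generalize d⁻¹ = D
  field_simp
  linear_combination (u0 * u1 * u2 * m * V0 * V1 * V2 * D) * key

/-- Boundary terms for the lattice `s = y / L`: the points `x / (q L)` and `x / L` precede the
common starting point `q x / L`. Applying `jackPrim_step` at them would require `L ≠ 1` and `q L ≠
1`, which regularity does not give, hence a separate identity needing only `q / L ≠ 1`. -/
theorem jackPrim_initial {q L x : ℂ} {a b : Fin 3 → ℂ} (hq : ‖q‖ < 1) (hq0 : q ≠ 0) (hL : L ≠ 0)
    (hx : x ≠ 0) (ha : ∀ j, a j ≠ 0) (hb : ∀ j, b j ≠ 0)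
    (hab : a 0 * a 1 * a 2 = q ^ 2 * L ^ 2 * (b 0 * b 1 * b 2))
    (h1 : ∀ j, x / a j ≠ 1) (h2 : ∀ j, q * x / a j ≠ 1) (h3 : q / L ≠ 1) :
    (x - a 0) * (x - a 1) * (x - a 2) *
        (jackTerm q L a b (x / q) (x / (q * L)) + jackTerm q L a b (x / q) (x / L))
      + midCoeff q L a b x * jackTerm q L a b x (x / L)
    = jackPrim q L a b x (q * x / L) := by
  have E := fun z => qPochInf_eq_mul z q hq
  have key := initial_identity (x := x) hq0 hL ha hb hab
  have n1 : ∀ j, 1 - x / a j ≠ 0 := fun j => sub_ne_zero.2 (h1 j).symm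
  have n2 : ∀ j, 1 - q * x / a j ≠ 0 := fun j => sub_ne_zero.2 (h2 j).symm
  have r := sub_ne_zero.2 h3.symm
  have v0 := n1 0
  have v1 := n1 1
  have v2 := n1 2
  have w0 := n2 0
  have w1 := n2 1
  have w2 := n2 2
  have hA : -(a 0 * a 1 * a 2) = (x - a 0) * (x - a 1) * (x - a 2)
      / ((1 - x / a 0) * (1 - x / a 1) * (1 - x / a 2)) := by
    rw [eq_div_iff (mul_ne_zero (mul_ne_zero v0 v1) v2)]
    have a0 := ha 0
    have a1 := ha 1
    have a2 := ha 2
    field_simp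
    ring
  rw [hA] at key
  have f1 : ∀ j, q * (x / (q * L)) / b j = x / (L * b j) := fun j => by
    field_simp
  have f2 : ∀ j, q * L * (x / (q * L)) / a j = x / a j := fun j => by
    field_simp
  have f3 : ∀ j, q * L * (x / L) / a j = q * (x / a j) := fun j => by
    field_simp
  have f4 : ∀ j, q * (x / L) / b j = q * (x / (L * b j)) := fun j => by
    field_simp
  have f5 : ∀ j, q * L * (q * x / L) / a j = q * (q * x / a j) := fun j => by
    field_simp
  have f6 : ∀ j, q * x / L / b j = q * (x / (L * b j)) := fun j => by
    field_simp
  have f7 : ∀ j, q * (x / a j) = q * x / a j := fun j => by ring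
  simp only [jackTerm, jackPrim, f1, f2, f3, f4, f5, f6]
  rw [show q * L * (x / (q * L)) / (x / q) = q by field_simp,
    show q * (x / (q * L)) / (x / q) = q / L by field_simp,
    show q * L * (x / L) / (x / q) = q * q by field_simp,
    show q * (x / L) / (x / q) = q * (q / L) by field_simp,
    show q * L * (x / L) / x = q by field_simp,
    show q * (x / L) / x = q / L by field_simp,
    show q * L * (q * x / L) / x = q * q by field_simp,
    show q * x / L / x = q / L by field_simp,
    E (x / a 0), E (x / a 1), E (x / a 2), f7, f7, f7,
    E (q * x / a 0), E (q * x / a 1), E (q * x / a 2),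
    E (x / (L * b 0)), E (x / (L * b 1)), E (x / (L * b 2)), E (q / L), E q]
  generalize qPochInf (q * (q * x / a 0)) q = V0
  generalize qPochInf (q * (q * x / a 1)) q = V1
  generalize qPochInf (q * (q * x / a 2)) q = V2
  generalize qPochInf (q * (x / (L * b 0))) q = u0
  generalize qPochInf (q * (x / (L * b 1))) q = u1
  generalize qPochInf (q * (x / (L * b 2))) q = u2
  generalize qPochInf (q * q) q = m
  generalize qPochInf (q * (q / L)) q = d
  generalize midCoeff q L a b x = C at *
  generalize (x - a 0) * (x - a 1) * (x - a 2) = A at *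
  generalize q * (b 0 * b 1 * b 2) * (1 - L) * x = c at *
  generalize x / a 0 = α0 at *
  generalize x / a 1 = α1 at *
  generalize x / a 2 = α2 at *
  generalize q * x / a 0 = γ0 at *
  generalize q * x / a 1 = γ1 at *
  generalize q * x / a 2 = γ2 at *
  generalize x / (L * b 0) = β0 at *
  generalize x / (L * b 1) = β1 at *
  generalize x / (L * b 2) = β2 at *
  generalize x / (q * L) = s0 at *
  generalize x / L = s1 at *
  generalize q / L = ρ at *
  clear f1 f2 f3 f4 f5 f6 f7 hA n1 n2 h1 h2 h3 hab ha hb hq hq0 hL hx E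
  simp only [div_eq_mul_inv, mul_inv] at key ⊢
  generalize V0⁻¹ = W0
  generalize V1⁻¹ = W1
  generalize V2⁻¹ = W2
  generalize d⁻¹ = D
  field_simp at key ⊢
  linear_combination (u0 * u1 * u2 * m * W0 * W1 * W2 * D) * key

theorem tendsto_jackPrim (q L x s : ℂ) (a b : Fin 3 → ℂ) (hq : ‖q‖ < 1) :
    Tendsto (fun n : ℕ => jackPrim q L a b x (s * q ^ n)) atTop
      (𝓝 (q * (b 0 * b 1 * b 2) * (1 - L) * x)) := by
  have T : ∀ w y : ℂ, Tendsto (fun n : ℕ => qPochInf (w * (s * q ^ n) / y) q) atTop (𝓝 1) := by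
    intro w y
    have e : (fun n : ℕ => qPochInf (w * (s * q ^ n) / y) q)
        = fun n : ℕ => qPochInf (w * s / y * q ^ n) q := by
      funext n
      congr 1
      ring
    rw [e]
    exact tendsto_qPochInf_mul_pow _ q hq
  have T1 : ∀ y : ℂ, Tendsto (fun n : ℕ => qPochInf (s * q ^ n / y) q) atTop (𝓝 1) := by
    intro y
    simpa using T 1 y
  have h := ((tendsto_const_nhds (x := q * (b 0 * b 1 * b 2) * (1 - L) * x)).mul
    ((((T1 (b 0)).mul (T1 (b 1))).mul (T1 (b 2))).div
      (((T (q * L) (a 0)).mul (T (q * L) (a 1))).mul (T (q * L) (a 2))) (by norm_num))).mul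
    ((T (q * L) x).div (T1 x) one_ne_zero)
  simp only [mul_one, div_one] at h
  exact h

/-! ### The two Jackson sums and their equations. -/

/-- The normalized `₄φ₃`. -/
noncomputable def normHyp (a : Fin 4 → ℂ) (b : Fin 3 → ℂ) (q : ℂ) : ℂ :=
  normFactor a b q * qHyp a b q q

/-- Upper parameters of the solution attached to the zero `b 0`. -/
noncomputable def upperB (q L : ℂ) (a b : Fin 3 → ℂ) (y : ℂ) : Fin 4 → ℂ :=
  ![q * b 0 / y, q * L * b 0 / a 0, q * L * b 0 / a 1, q * L * b 0 / a 2]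

/-- Lower parameters of the solution attached to the zero `b 0`. -/
noncomputable def lowerB (q L : ℂ) (b : Fin 3 → ℂ) (y : ℂ) : Fin 3 → ℂ :=
  ![q * L * b 0 / y, q * b 0 / b 1, q * b 0 / b 2]

/-- Upper parameters of the solution attached to the origin. -/
noncomputable def upperO (q L : ℂ) (a : Fin 3 → ℂ) (y : ℂ) : Fin 4 → ℂ :=
  ![q * y / a 0, q * y / a 1, q * y / a 2, q / L]

/-- Lower parameters of the solution attached to the origin. -/
noncomputable def lowerO (q L : ℂ) (b : Fin 3 → ℂ) (y : ℂ) : Fin 3 → ℂ :=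
  ![q * y / (L * b 0), q * y / (L * b 1), q * y / (L * b 2)]

theorem hasSum_jackTerm_B {q L y : ℂ} {a b : Fin 3 → ℂ} (hq : ‖q‖ < 1) (hb : ∀ j, b j ≠ 0)
    (h : QRegular (upperB q L a b y) (lowerB q L b y) q) :
    HasSum (fun n : ℕ => jackTerm q L a b y (b 0 * q ^ n))
      (b 0 * normHyp (upperB q L a b y) (lowerB q L b y) q) := by
  have e : (fun n : ℕ => jackTerm q L a b y (b 0 * q ^ n))
      = fun n => b 0 * normTerm (upperB q L a b y) (lowerB q L b y) q n := by
    funext n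
    have b0 := hb 0
    have f : ∀ w z : ℂ, w * (b 0 * q ^ n) / z = w * b 0 / z * q ^ n := fun w z => by ring
    -- On this lattice the factor with `b 0` becomes the `(q; q)` symbol of the series.
    have f0 : q * b 0 / b 0 = q := by field_simp
    simp only [jackTerm, normTerm, upperB, lowerB, f, f0, Matrix.cons_val]
    simp only [div_eq_mul_inv, mul_inv]
    ring
  rw [e]
  exact (hasSum_normTerm hq h).mul_left _

theorem hasSum_jackTerm_O {q L y : ℂ} {a b : Fin 3 → ℂ} (hq : ‖q‖ < 1) (hL : L ≠ 0) (hy : y ≠ 0)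
    (h : QRegular (upperO q L a y) (lowerO q L b y) q) :
    HasSum (fun n : ℕ => jackTerm q L a b y (y / L * q ^ n))
      (y / L * normHyp (upperO q L a y) (lowerO q L b y) q) := by
  have e : (fun n : ℕ => jackTerm q L a b y (y / L * q ^ n))
      = fun n => y / L * normTerm (upperO q L a y) (lowerO q L b y) q n := by
    funext n
    have f1 : ∀ z : ℂ, q * L * (y / L * q ^ n) / z = q * y / z * q ^ n := fun z => by
      field_simp
    have f2 : ∀ z : ℂ, q * (y / L * q ^ n) / z = q * y / (L * z) * q ^ n := fun z => by
      field_simp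
    have f3 : q * y / y = q := by field_simp
    have f4 : q * y / (L * y) = q / L := by field_simp
    simp only [jackTerm, normTerm, upperO, lowerO, f1, f2, f3, f4, Matrix.cons_val]
    simp only [div_eq_mul_inv, mul_inv]
    ring
  rw [e]
  exact (hasSum_normTerm hq h).mul_left _

theorem normHyp_B_equation {q L x : ℂ} {a b : Fin 3 → ℂ} (hq : ‖q‖ < 1) (hq0 : q ≠ 0)
    (hL : L ≠ 0) (hx : x ≠ 0) (ha : ∀ j, a j ≠ 0) (hb : ∀ j, b j ≠ 0)
    (hab : a 0 * a 1 * a 2 = q ^ 2 * L ^ 2 * (b 0 * b 1 * b 2))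
    (h1 : QRegular (upperB q L a b (x / q)) (lowerB q L b (x / q)) q)
    (h2 : QRegular (upperB q L a b x) (lowerB q L b x) q)
    (h3 : QRegular (upperB q L a b (q * x)) (lowerB q L b (q * x)) q) :
    (x - a 0) * (x - a 1) * (x - a 2)
        * (b 0 * normHyp (upperB q L a b (x / q)) (lowerB q L b (x / q)) q)
      + q * ((x - b 0) * (x - b 1) * (x - b 2))
        * (b 0 * normHyp (upperB q L a b (q * x)) (lowerB q L b (q * x)) q)
      + midCoeff q L a b x * (b 0 * normHyp (upperB q L a b x) (lowerB q L b x) q)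
    = q * (b 0 * b 1 * b 2) * (1 - L) * x := by
  have H := (((hasSum_jackTerm_B hq hb h1).mul_left ((x - a 0) * (x - a 1) * (x - a 2))).add
    ((hasSum_jackTerm_B hq hb h3).mul_left (q * ((x - b 0) * (x - b 1) * (x - b 2))))).add
    ((hasSum_jackTerm_B hq hb h2).mul_left (midCoeff q L a b x))
  refine tendsto_nhds_unique H.tendsto_sum_nat
    ((tendsto_jackPrim q L x (b 0) a b hq).congr fun N => ?_)
  induction N with
  | zero =>
    -- The boundary value at `s = b 0` contains `(1; q)_∞ = 0`.
    simp [jackPrim, hb 0, qPochInf_one q hq]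
  | succ N ih =>
    rw [Finset.sum_range_succ, ← ih]
    have hw : ∀ j, q * L * (b 0 * q ^ N) / a j ≠ 1 := by
      intro j
      rw [show q * L * (b 0 * q ^ N) / a j = q * L * b 0 / a j * q ^ N by ring]
      fin_cases j
      · exact h2.1 1 N
      · exact h2.1 2 N
      · exact h2.1 3 N
    -- Regularity at `x` only controls the factors from `q s / x` on; this one comes from regularity
    -- at `q x`.
    have g1 : b 0 * q ^ N / x ≠ 1 := by
      rw [show b 0 * q ^ N / x = q * b 0 / (q * x) * q ^ N by field_simp]
      exact h3.1 0 N
    have g2 : q * (b 0 * q ^ N) / x ≠ 1 := by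
      rw [show q * (b 0 * q ^ N) / x = q * b 0 / x * q ^ N by ring]
      exact h2.1 0 N
    rw [jackPrim_step hq hq0 hL hx ha hb hab hw g1 g2,
      show b 0 * q ^ (N + 1) = q * (b 0 * q ^ N) by ring]
    ring

theorem normHyp_O_equation {q L x : ℂ} {a b : Fin 3 → ℂ} (hq : ‖q‖ < 1) (hq0 : q ≠ 0)
    (hL : L ≠ 0) (hx : x ≠ 0) (ha : ∀ j, a j ≠ 0) (hb : ∀ j, b j ≠ 0)
    (hab : a 0 * a 1 * a 2 = q ^ 2 * L ^ 2 * (b 0 * b 1 * b 2))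
    (h1 : QRegular (upperO q L a (x / q)) (lowerO q L b (x / q)) q)
    (h2 : QRegular (upperO q L a x) (lowerO q L b x) q)
    (h3 : QRegular (upperO q L a (q * x)) (lowerO q L b (q * x)) q) :
    (x - a 0) * (x - a 1) * (x - a 2)
        * (x / q / L * normHyp (upperO q L a (x / q)) (lowerO q L b (x / q)) q)
      + q * ((x - b 0) * (x - b 1) * (x - b 2))
        * (q * x / L * normHyp (upperO q L a (q * x)) (lowerO q L b (q * x)) q)
      + midCoeff q L a b x * (x / L * normHyp (upperO q L a x) (lowerO q L b x) q)
    = q * (b 0 * b 1 * b 2) * (1 - L) * x := by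
  have S1 := (hasSum_jackTerm_O hq hL (div_ne_zero hx hq0) h1).tendsto_sum_nat
  have S2 := (hasSum_jackTerm_O hq hL hx h2).tendsto_sum_nat
  have S3 := (hasSum_jackTerm_O hq hL (mul_ne_zero hq0 hx) h3).tendsto_sum_nat
  -- The lattices for `x / q`, `x`, `q x` start at `x / (q L)`, `x / L`, `q x / L`. Taking `N + 2`,
  -- `N + 1`, `N` terms makes all three partial sums end at the same point.
  have H := (((S1.comp (tendsto_add_atTop_nat 2)).const_mul
      ((x - a 0) * (x - a 1) * (x - a 2))).add
    (S3.const_mul (q * ((x - b 0) * (x - b 1) * (x - b 2))))).add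
    ((S2.comp (tendsto_add_atTop_nat 1)).const_mul (midCoeff q L a b x))
  refine tendsto_nhds_unique H
    ((tendsto_jackPrim q L x (q * x / L) a b hq).congr fun N => ?_)
  simp only [Function.comp_apply]
  have hα : ∀ (j : Fin 3) (n : ℕ), q * x / a j * q ^ n ≠ 1 := by
    intro j n
    fin_cases j
    · exact h2.1 0 n
    · exact h2.1 1 n
    · exact h2.1 2 n
  have hα' : ∀ j : Fin 3, x / a j ≠ 1 := by
    intro j
    rw [show x / a j = q * (x / q) / a j * q ^ 0 by field_simp]
    fin_cases j
    · exact h1.1 0 0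
    · exact h1.1 1 0
    · exact h1.1 2 0
  have hρ : ∀ n : ℕ, q / L * q ^ n ≠ 1 := fun n => h2.1 3 n
  induction N with
  | zero =>
    have := jackPrim_initial hq hq0 hL hx ha hb hab hα' (fun j => by simpa using hα j 0)
      (by simpa using hρ 0)
    simp only [Finset.sum_range_succ, Finset.sum_range_zero, pow_zero, mul_one, zero_add, pow_one,
      mul_zero, add_zero]
    rw [← this, show x / q / L * q = x / L by field_simp, div_div]
  | succ N ih =>
    have r1 := Finset.sum_range_succ
      (fun i => jackTerm q L a b (x / q) (x / q / L * q ^ i)) (N + 2)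
    have r2 := Finset.sum_range_succ (fun i => jackTerm q L a b x (x / L * q ^ i)) (N + 1)
    have r3 := Finset.sum_range_succ
      (fun i => jackTerm q L a b (q * x) (q * x / L * q ^ i)) N
    rw [show x / q / L * q ^ (N + 2) = q * x / L * q ^ N by field_simp; ring] at r1
    rw [show x / L * q ^ (N + 1) = q * x / L * q ^ N by ring] at r2
    rw [show N + 1 + 2 = (N + 2) + 1 by ring, r1, r2, r3,
      show q * x / L * q ^ (N + 1) = q * (q * x / L * q ^ N) by ring]
    have hw : ∀ j, q * L * (q * x / L * q ^ N) / a j ≠ 1 := by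
      intro j
      rw [show q * L * (q * x / L * q ^ N) / a j = q * x / a j * q ^ (N + 1) by
        field_simp
        ring]
      exact hα j (N + 1)
    have g1 : q * x / L * q ^ N / x ≠ 1 := by
      rw [show q * x / L * q ^ N / x = q / L * q ^ N by field_simp]
      exact hρ N
    have g2 : q * (q * x / L * q ^ N) / x ≠ 1 := by
      rw [show q * (q * x / L * q ^ N) / x = q / L * q ^ (N + 1) by field_simp; ring]
      exact hρ (N + 1)
    have step := jackPrim_step hq hq0 hL hx ha hb hab hw g1 g2
    linear_combination ih - step

/-! ### Powers of `q` and translation back to the parameters `h`, `l`, `t`. -/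

theorem powLog_add (L a b : ℂ) : powLog L (a + b) = powLog L a * powLog L b := by
  rw [powLog, powLog, powLog, ← Complex.exp_add, add_mul]

theorem powLog_neg (L a : ℂ) : powLog L (-a) = (powLog L a)⁻¹ := by
  rw [powLog, powLog, ← Complex.exp_neg, neg_mul]

theorem powLog_sub (L a b : ℂ) : powLog L (a - b) = powLog L a / powLog L b := by
  rw [sub_eq_add_neg, powLog_add, powLog_neg, div_eq_mul_inv]

theorem powLog_one (L : ℂ) : powLog L 1 = Complex.exp L := by
  rw [powLog, one_mul]

theorem powLog_ne_zero (L a : ℂ) : powLog L a ≠ 0 := Complex.exp_ne_zero _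

theorem powLog_half_sq (L : ℂ) : powLog L (1 / 2) ^ 2 = Complex.exp L := by
  rw [sq, ← powLog_add, ← powLog_one]
  norm_num

theorem powLog_three_halves (L : ℂ) : powLog L (3 / 2) = powLog L (1 / 2) ^ 3 := by
  rw [show (3 / 2 : ℂ) = 1 / 2 + 1 / 2 + 1 / 2 by norm_num, powLog_add, powLog_add]
  ring

namespace QDegThree

/-- The zeros of the coefficient of `g (x / q)`. -/
noncomputable def zeroA (τ : ℂ) (h t : Fin 3 → ℂ) (j : Fin 3) : ℂ :=
  powLog τ (h j + 1 / 2) * t j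

/-- The zeros of the coefficient of `g (q * x)`. -/
noncomputable def zeroB (τ : ℂ) (l t : Fin 3 → ℂ) (j : Fin 3) : ℂ :=
  powLog τ (l j - 1 / 2) * t j

theorem zeroA_ne_zero {τ : ℂ} (h : Fin 3 → ℂ) {t : Fin 3 → ℂ} (ht : ∀ j, t j ≠ 0) (j : Fin 3) :
    zeroA τ h t j ≠ 0 := mul_ne_zero (powLog_ne_zero _ _) (ht j)

theorem zeroB_ne_zero {τ : ℂ} (l : Fin 3 → ℂ) {t : Fin 3 → ℂ} (ht : ∀ j, t j ≠ 0) (j : Fin 3) :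
    zeroB τ l t j ≠ 0 := mul_ne_zero (powLog_ne_zero _ _) (ht j)

theorem powLog_lam_sq (τ : ℂ) (h l : Fin 3 → ℂ) :
    powLog τ (lam h l) ^ 2 * (powLog τ (l 0) * powLog τ (l 1) * powLog τ (l 2))
      = powLog τ (h 0) * powLog τ (h 1) * powLog τ (h 2) * powLog τ (1 / 2) ^ 2 := by
  simp only [sq, ← powLog_add]
  congr 1
  rw [lam]
  ring

theorem prod_zeroA (τ : ℂ) (h l t : Fin 3 → ℂ) :
    zeroA τ h t 0 * zeroA τ h t 1 * zeroA τ h t 2 = Complex.exp τ ^ 2 * powLog τ (lam h l) ^ 2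
      * (zeroB τ l t 0 * zeroB τ l t 1 * zeroB τ l t 2) := by
  have w := powLog_ne_zero τ (1 / 2)
  simp only [zeroA, zeroB, powLog_add, powLog_sub, ← powLog_half_sq]
  field_simp
  linear_combination -(t 0 * t 1 * t 2) * powLog_lam_sq τ h l

theorem midCoeff_zeros (τ : ℂ) (h l t : Fin 3 → ℂ) (x : ℂ) :
    (-(Complex.exp τ + 1) * x ^ 3
        + powLog τ (1 / 2) *
          ((powLog τ (h 0) + powLog τ (l 0)) * t 0 + (powLog τ (h 1) + powLog τ (l 1)) * t 1
            + (powLog τ (h 2) + powLog τ (l 2)) * t 2) * x ^ 2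
        - powLog τ ((h 0 + h 1 + h 2 + l 0 + l 1 + l 2 + 1) / 2) *
          ((powLog τ (-h 0) + powLog τ (-l 0)) * t 1 * t 2
            + (powLog τ (-h 1) + powLog τ (-l 1)) * t 0 * t 2
            + (powLog τ (-h 2) + powLog τ (-l 2)) * t 0 * t 1) * x
        + powLog τ ((h 0 + h 1 + h 2 + l 0 + l 1 + l 2) / 2) * (Complex.exp τ + 1)
          * t 0 * t 1 * t 2)
      = midCoeff (Complex.exp τ) (powLog τ (lam h l)) (zeroA τ h t) (zeroB τ l t) x := by
  -- Expressing the half-sum exponents through `λ` fixes which square root of the product of powers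
  -- occurs; `powLog_lam_sq` alone determines `q^λ` only up to sign.
  have e1 : (h 0 + h 1 + h 2 + l 0 + l 1 + l 2 + 1) / 2 = lam h l + l 0 + l 1 + l 2 := by
    rw [lam]
    ring
  have e2 : (h 0 + h 1 + h 2 + l 0 + l 1 + l 2) / 2 = lam h l + l 0 + l 1 + l 2 - 1 / 2 := by
    rw [lam]
    ring
  have key := powLog_lam_sq τ h l
  have w := powLog_ne_zero τ (1 / 2)
  have n := powLog_ne_zero τ (lam h l)
  have h0 := powLog_ne_zero τ (h 0)
  have h1 := powLog_ne_zero τ (h 1)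
  have h2 := powLog_ne_zero τ (h 2)
  have l0 := powLog_ne_zero τ (l 0)
  have l1 := powLog_ne_zero τ (l 1)
  have l2 := powLog_ne_zero τ (l 2)
  rw [e1, e2, midCoeff]
  simp only [zeroA, zeroB, powLog_add, powLog_sub, powLog_neg, ← powLog_half_sq]
  generalize powLog τ (1 / 2) = W at *
  generalize powLog τ (lam h l) = N at *
  generalize powLog τ (h 0) = H0 at *
  generalize powLog τ (h 1) = H1 at *
  generalize powLog τ (h 2) = H2 at *
  generalize powLog τ (l 0) = L0 at *
  generalize powLog τ (l 1) = L1 at *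
  generalize powLog τ (l 2) = L2 at *
  have k0 : L0 = H0 * H1 * H2 * W ^ 2 / (N ^ 2 * L1 * L2) := by
    rw [← key]
    field_simp
  subst k0
  field_simp
  ring

/-- Removal of `α`: the shifts multiply `x^(-α)` by `q^α` and `q^(-α)`, so with the given
coefficients every term carries the common factor `q^α x^(-α)`. -/
theorem satisfiesNonhom_of_eq {τ α : ℂ} {h l t : Fin 3 → ℂ} {g k : ℂ → ℂ} {u : ℂ}
    (hg : ∀ v, g v = powLog v (-α) * k v)
    (hk : (Complex.exp u - zeroA τ h t 0) * (Complex.exp u - zeroA τ h t 1)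
          * (Complex.exp u - zeroA τ h t 2) * k (u - τ)
        + Complex.exp τ * ((Complex.exp u - zeroB τ l t 0) * (Complex.exp u - zeroB τ l t 1)
          * (Complex.exp u - zeroB τ l t 2)) * k (u + τ)
        + midCoeff (Complex.exp τ) (powLog τ (lam h l)) (zeroA τ h t) (zeroB τ l t)
          (Complex.exp u) * k u
      = Complex.exp τ * (zeroB τ l t 0 * zeroB τ l t 1 * zeroB τ l t 2)
        * (1 - powLog τ (lam h l)) * Complex.exp u) :
    SatisfiesNonhom τ α h l t g u := by
  have p1 : powLog (u - τ) (-α) = powLog u (-α) * powLog τ α := by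
    simp only [powLog, ← Complex.exp_add]
    ring_nf
  have p2 : powLog τ (2 * α + 1) * powLog (u + τ) (-α)
      = powLog u (-α) * powLog τ α * Complex.exp τ := by
    simp only [powLog, ← Complex.exp_add]
    ring_nf
  have p3 : powLog u (1 - α) = Complex.exp u * powLog u (-α) := by
    simp only [powLog, ← Complex.exp_add]
    ring_nf
  have p4 : powLog τ (α + l 0 + l 1 + l 2 - 1 / 2) * t 0 * t 1 * t 2 = powLog τ α *
      (Complex.exp τ * (zeroB τ l t 0 * zeroB τ l t 1 * zeroB τ l t 2)) := by
    have w := powLog_ne_zero τ (1 / 2)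
    simp only [zeroB, powLog_add, powLog_sub, ← powLog_half_sq]
    field_simp
  simp only [SatisfiesNonhom, variantLHS]
  rw [midCoeff_zeros, p3, p4, hg, hg, hg, p1]
  simp only [zeroA, zeroB] at hk ⊢
  linear_combination (powLog u (-α) * powLog τ α) * hk
    + (Complex.exp u - powLog τ (l 0 - 1 / 2) * t 0) * (Complex.exp u - powLog τ (l 1 - 1 / 2) * t 1)
      * (Complex.exp u - powLog τ (l 2 - 1 / 2) * t 2) * k (u + τ) * p2

theorem upperI_eq (τ : ℂ) (h l : Fin 3 → ℂ) {t : Fin 3 → ℂ} (ht : ∀ j, t j ≠ 0)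
    (σ : Equiv.Perm (Fin 3)) (u : ℂ) :
    upperI τ h l t σ u = upperB (Complex.exp τ) (powLog τ (lam h l)) (zeroA τ h t ∘ σ)
      (zeroB τ l t ∘ σ) (Complex.exp u) := by
  have w := powLog_ne_zero τ (1 / 2)
  have hh := fun j => powLog_ne_zero τ (h j)
  simp only [upperI, upperB, Function.comp_apply, zeroA, zeroB, powLog_add, powLog_sub,
    ← powLog_half_sq]
  have t0 := ht (σ 0)
  congr 1 <;> [skip; congr 1 <;> [skip; congr 1 <;> [skip; congr 1]]] <;> field_simp

theorem lowerI_eq (τ : ℂ) (h l : Fin 3 → ℂ) (t : Fin 3 → ℂ) (σ : Equiv.Perm (Fin 3)) (u : ℂ) :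
    lowerI τ h l t σ u = lowerB (Complex.exp τ) (powLog τ (lam h l))
      (zeroB τ l t ∘ σ) (Complex.exp u) := by
  have w := powLog_ne_zero τ (1 / 2)
  simp only [lowerI, lowerB, Function.comp_apply, zeroB, powLog_add, powLog_sub, powLog_one,
    ← powLog_half_sq]
  congr 1 <;> [skip; congr 1 <;> [skip; congr 1]] <;> field_simp

theorem upperZero_eq (τ : ℂ) (h l t : Fin 3 → ℂ) (u : ℂ) :
    upperZero τ h l t u = upperO (Complex.exp τ) (powLog τ (lam h l)) (zeroA τ h t)
      (Complex.exp u) := by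
  have w := powLog_ne_zero τ (1 / 2)
  simp only [upperZero, upperO, zeroA, powLog_add, powLog_neg, powLog_one, ← powLog_half_sq]
  congr 1 <;> [skip; congr 1 <;> [skip; congr 1 <;> [skip; congr 1]]] <;> field_simp

theorem lowerZero_eq (τ : ℂ) (h l t : Fin 3 → ℂ) (u : ℂ) :
    lowerZero τ h l t u = lowerO (Complex.exp τ) (powLog τ (lam h l)) (zeroB τ l t)
      (Complex.exp u) := by
  have w := powLog_ne_zero τ (1 / 2)
  simp only [lowerZero, lowerO, zeroB, powLog_add, powLog_sub, powLog_neg, powLog_three_halves,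
    ← powLog_half_sq]
  congr 1 <;> [skip; congr 1 <;> [skip; congr 1]] <;> field_simp

/-- Symmetry in the indices reduces every `g_i` to the solution attached to `b 0`, with `a` and `b`
reindexed by `σ`. -/
theorem midCoeff_perm (q L : ℂ) (a b : Fin 3 → ℂ) (σ : Equiv.Perm (Fin 3)) (x : ℂ) :
    midCoeff q L (a ∘ σ) (b ∘ σ) x = midCoeff q L a b x := by
  have s1 : ∀ f : Fin 3 → ℂ, f (σ 0) + f (σ 1) + f (σ 2) = f 0 + f 1 + f 2 := fun f => by
    simpa [Fin.sum_univ_three] using Equiv.sum_comp σ f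
  have s2 : ∀ f : Fin 3 → ℂ, f (σ 1) * f (σ 2) + f (σ 0) * f (σ 2) + f (σ 0) * f (σ 1)
      = f 1 * f 2 + f 0 * f 2 + f 0 * f 1 := fun f => by
    -- Newton's identity: the second elementary symmetric function is half of the squared sum minus
    -- the sum of squares.
    linear_combination ((f (σ 0) + f (σ 1) + f (σ 2) + f 0 + f 1 + f 2) / 2) * s1 f
      - s1 (fun j => f j ^ 2) / 2
  have s3 : b (σ 0) * b (σ 1) * b (σ 2) = b 0 * b 1 * b 2 := by
    simpa [Fin.prod_univ_three] using Equiv.prod_comp σ b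
  have e := s1 fun j => a j + q * b j
  simp only [midCoeff, Function.comp_apply]
  rw [s2 a, s2 b, s3, e]

theorem gI_satisfiesNonhom {τ α : ℂ} {h l t : Fin 3 → ℂ} (hq : ‖Complex.exp τ‖ < 1)
    (ht : ∀ j, t j ≠ 0) (σ : Equiv.Perm (Fin 3)) {u : ℂ} (h1 : DefinedI τ h l t σ (u - τ))
    (h2 : DefinedI τ h l t σ u) (h3 : DefinedI τ h l t σ (u + τ)) :
    SatisfiesNonhom τ α h l t (gI τ α h l t σ) u := by
  refine satisfiesNonhom_of_eq (k := fun v => zeroB τ l t (σ 0) *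
    normHyp (upperI τ h l t σ v) (lowerI τ h l t σ v) (Complex.exp τ)) (fun v => ?_) ?_
  · simp only [gI, normHyp, normFactor, zeroB]
    ring
  · have p : ∀ f : Fin 3 → ℂ, f 0 * f 1 * f 2 = f (σ 0) * f (σ 1) * f (σ 2) := fun f => by
      simpa [Fin.prod_univ_three] using (Equiv.prod_comp σ f).symm
    have x1 := Complex.exp_sub u τ
    have x2 : Complex.exp (u + τ) = Complex.exp τ * Complex.exp u := by
      rw [Complex.exp_add, mul_comm]
    unfold DefinedI at h1 h2 h3
    simp only [upperI_eq τ h l ht, lowerI_eq, x1, x2] at h1 h2 h3 ⊢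
    have hab := prod_zeroA τ h l t
    rw [p (zeroA τ h t), p (zeroB τ l t)] at hab
    have key := normHyp_B_equation (a := zeroA τ h t ∘ σ) (b := zeroB τ l t ∘ σ) hq
      (Complex.exp_ne_zero _) (powLog_ne_zero _ _)
      (Complex.exp_ne_zero _) (fun j => zeroA_ne_zero h ht (σ j))
      (fun j => zeroB_ne_zero l ht (σ j)) hab h1 h2 h3
    rw [midCoeff_perm] at key
    rw [p fun j => Complex.exp u - zeroA τ h t j, p fun j => Complex.exp u - zeroB τ l t j,
      p (zeroB τ l t)]
    exact key

theorem gZero_satisfiesNonhom {τ α : ℂ} {h l t : Fin 3 → ℂ} (hq : ‖Complex.exp τ‖ < 1)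
    (ht : ∀ j, t j ≠ 0) {u : ℂ} (h1 : DefinedZero τ h l t (u - τ))
    (h2 : DefinedZero τ h l t u) (h3 : DefinedZero τ h l t (u + τ)) :
    SatisfiesNonhom τ α h l t (gZero τ α h l t) u := by
  -- The prefactor `x / q^λ` is the first lattice point `y / L`, just as the prefactor of `g_i` is
  -- `b i`.
  refine satisfiesNonhom_of_eq (k := fun v => Complex.exp v / powLog τ (lam h l) *
    normHyp (upperZero τ h l t v) (lowerZero τ h l t v) (Complex.exp τ)) (fun v => ?_) ?_
  · simp only [gZero, normHyp, normFactor, powLog_neg, powLog_sub, powLog_one]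
    ring
  · have x1 := Complex.exp_sub u τ
    have x2 : Complex.exp (u + τ) = Complex.exp τ * Complex.exp u := by
      rw [Complex.exp_add, mul_comm]
    unfold DefinedZero at h1 h2 h3
    simp only [upperZero_eq, lowerZero_eq, x1, x2] at h1 h2 h3 ⊢
    exact normHyp_O_equation hq (Complex.exp_ne_zero _) (powLog_ne_zero _ _)
      (Complex.exp_ne_zero _) (zeroA_ne_zero h ht) (zeroB_ne_zero l ht)
      (prod_zeroA τ h l t) h1 h2 h3

end QDegThree

theorem theorem4p9 (q τ α : ℂ) (h l t : Fin 3 → ℂ)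
    (hq0 : 0 < ‖q‖) (hq1 : ‖q‖ < 1) (hτ : Complex.exp τ = q) (ht : ∀ j, t j ≠ 0) :
    (∀ σ : Equiv.Perm (Fin 3),
      (∀ u : ℂ, QDegThree.DefinedI τ h l t σ u →
        Summable fun n : ℕ =>
          ‖qHypTerm (QDegThree.upperI τ h l t σ u) (QDegThree.lowerI τ h l t σ u) q q n‖) ∧
      (∀ u : ℂ, QDegThree.DefinedI τ h l t σ (u - τ) → QDegThree.DefinedI τ h l t σ u →
        QDegThree.DefinedI τ h l t σ (u + τ) →
        QDegThree.SatisfiesNonhom τ α h l t (QDegThree.gI τ α h l t σ) u)) ∧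
    ((∀ u : ℂ, QDegThree.DefinedZero τ h l t u →
        Summable fun n : ℕ =>
          ‖qHypTerm (QDegThree.upperZero τ h l t u) (QDegThree.lowerZero τ h l t u) q q n‖) ∧
      (∀ u : ℂ, QDegThree.DefinedZero τ h l t (u - τ) → QDegThree.DefinedZero τ h l t u →
        QDegThree.DefinedZero τ h l t (u + τ) →
        QDegThree.SatisfiesNonhom τ α h l t (QDegThree.gZero τ α h l t) u)) := by
  subst hτ
  exact ⟨fun σ => ⟨fun u hu => summable_norm_qHypTerm hq1 hu,
      fun u h1 h2 h3 => QDegThree.gI_satisfiesNonhom hq1 ht σ h1 h2 h3⟩,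
    fun u hu => summable_norm_qHypTerm hq1 hu,
    fun u h1 h2 h3 => QDegThree.gZero_satisfiesNonhom hq1 ht h1 h2 h3⟩
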